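/- Let $k$ be a field and let $n\ge 2$. Let $\Gamma_{D_n}$ be the Hasse graph of an $n$-gon, i.e. the layered directed graph with one vertex $*$ on level $0$, vertices $w_i$ ($i\in\mathbb{Z}/n$) on level $1$, vertices $v_{i,i+1}$ ($i\in\mathbb{Z}/n$) on level $2$ and one vertex $u$ on level $3$, and with edges $u\to v_{i,i+1}$, $v_{i,i+1}\to w_i$, $v_{i,i+1}\to w_{i+1}$ and $w_i\to *$ for $i\in\mathbb{Z}/n$. For a layered directed graph $\Gamma$ with edge set $E$, let $T(E)$ be the free associative $k$-algebra on $E$; for a path $\pi=(e_1,\dots,e_m)$ and $1\le j\le m$ put $e(\pi,j)=\sum_{1\le i_1<\cdots<i_j\le m}e_{i_1}\cdots e_{i_j}$, and let $A(\Gamma)=T(E)/R$, where $R$ is the two-sided ideal generated by all $e(\pi_1,j)-e(\pi_2,j)$ with $\pi_1,\pi_2$ paths having the same starting vertex and the same end vertex and $1\le j\le \mathrm{length}(\pi_1)$. Let $A(\Gamma)_{[i]}$ be the image in $A(\Gamma)$ of the span of the products of $i$ edges, and let $H(A(\Gamma),t)=\sum_{i\ge0}\dim_k\bigl(A(\Gamma)_{[i]}\bigr)t^i$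 be the Hilbert series. Then $$H(A(\Gamma_{D_n}),t)=\frac{1}{1-(2n+1)t+(2n-1)t^2-t^3}=\frac{1-t}{1-(2n+2)t+4nt^2-2nt^3+t^4}.$$ -/

import Mathlib

/-- A layered graph with vertex set `V` and edge set `E`: every edge goes from its tail to its head,
dropping the level by one; the levels are bounded; there is exactly one vertex `bot` (written `*`)
of level `0`; and every other vertex is the tail of at least one edge. -/
structure LayeredGraph (V E : Type*) where
  tail : E → V
  head : E → V
  level : V → ℕ
  level_tail : ∀ e, level (tail e) = level (head e) + 1
  level_bounded : ∃ N, ∀ v, level v ≤ N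
  bot : V
  level_eq_zero_iff : ∀ v, level v = 0 ↔ v = bot
  exists_tail_eq : ∀ v, v ≠ bot → ∃ e, tail e = v

namespace LayeredGraph

variable {V E : Type*} (Γ : LayeredGraph V E) (k : Type*) [Field k]

/-- `Γ.IsPath v w π`: the list of edges `π = [e₁, …, eₘ]` is a path from `v` to `w`, that is,
`tail e₁ = v`, `tail eᵢ₊₁ = head eᵢ` and `head eₘ = w` (with the empty path from `v` to `v`). -/
def IsPath : V → V → List E → Prop
  | v, w, [] => v = w
  | v, w, e :: π => Γ.tail e = v ∧ IsPath (Γ.head e) w π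

/-- The monomial `e₁ ⋯ eₘ` in the free associative algebra `T(E)`. -/
def monomial (π : List E) : FreeAlgebra k E :=
  (π.map (FreeAlgebra.ι k)).prod

/-- `e(π, j) = ∑_{i₁ < ⋯ < iⱼ} e_{i₁} ⋯ e_{iⱼ}` in `T(E)`, for `π = [e₁, …, eₘ]`. -/
def pathSum (π : List E) (j : ℕ) : FreeAlgebra k E :=
  ((π.sublistsLen j).map (monomial k)).sum

/-- The defining relations of `A(Γ)`: `e(π₁, j) = e(π₂, j)` for paths `π₁`, `π₂` with the same
starting vertex and the same final vertex, and `1 ≤ j ≤ l(π₁)`. -/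
inductive Rel : FreeAlgebra k E → FreeAlgebra k E → Prop
  | intro (v w : V) (π₁ π₂ : List E) (h₁ : Γ.IsPath v w π₁) (h₂ : Γ.IsPath v w π₂)
      (j : ℕ) (hj : 1 ≤ j) (hj' : j ≤ π₁.length) : Rel (pathSum k π₁ j) (pathSum k π₂ j)

/-- The algebra `A(Γ) = T(E) / R`, where `R` is the two-sided ideal generated by the differences
`e(π₁, j) - e(π₂, j)`. -/
abbrev Alg : Type _ := RingQuot (Γ.Rel k)

/-- `T(E)_[i]`: the span of the products of `i` edges in `T(E)`. -/
def tensorDegree (E : Type*) (i : ℕ) : Submodule k (FreeAlgebra k E) :=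
  Submodule.span k (monomial k '' {π : List E | π.length = i})

/-- `A(Γ)_[i] = (T(E)_[i] + R) / R`, the image of `T(E)_[i]` in `A(Γ)`. -/
def gradedPiece (i : ℕ) : Submodule k (Γ.Alg k) :=
  (tensorDegree k E i).map (RingQuot.mkAlgHom k (Γ.Rel k)).toLinearMap

/-- The graded pieces are finite-dimensional if there are finitely many edges, so that
their `finrank` is their dimension. -/
theorem finite_gradedPiece [Finite E] (i : ℕ) : Module.Finite k (Γ.gradedPiece k i) := by
  have h : Module.Finite k (tensorDegree k E i) :=
    FiniteDimensional.span_of_finite k ((List.finite_length_eq E i).image _)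
  exact Module.Finite.map _ _

/-- The Hilbert series `∑ᵢ dim(A(Γ)_[i]) tⁱ`. -/
noncomputable def hilbertSeries : PowerSeries ℚ :=
  PowerSeries.mk fun i => (Module.finrank k (Γ.gradedPiece k i) : ℚ)

end LayeredGraph

/-- The faces of an `n`-gon, indexed by `ℤ/n`: the empty face `*`, the vertices `wᵢ`, the edges
`v i = v_{i,i+1}` joining `wᵢ` to `wᵢ₊₁`, and the whole polygon `u`. -/
inductive PolygonFace (n : ℕ) : Type
  | bot : PolygonFace n
  | w (i : ZMod n) : PolygonFace n
  | v (i : ZMod n) : PolygonFace n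
  | u : PolygonFace n

/-- The edges of the Hasse graph of an `n`-gon: `u → v_{i,i+1}`, `v_{i,i+1} → wᵢ`,
`v_{i,i+1} → wᵢ₊₁` and `wᵢ → *`, for `i` in `ℤ/n`. -/
inductive PolygonEdge (n : ℕ) : Type
  | top (i : ZMod n) : PolygonEdge n
  | left (i : ZMod n) : PolygonEdge n
  | right (i : ZMod n) : PolygonEdge n
  | base (i : ZMod n) : PolygonEdge n

namespace PolygonFace

/-- The level of a face in the Hasse graph. -/
def level {n : ℕ} : PolygonFace n → ℕ
  | bot => 0
  | w _ => 1
  | v _ => 2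
  | u => 3

end PolygonFace

namespace PolygonEdge

def tail {n : ℕ} : PolygonEdge n → PolygonFace n
  | top _ => .u
  | left i => .v i
  | right i => .v i
  | base i => .w i

def head {n : ℕ} : PolygonEdge n → PolygonFace n
  | top i => .v i
  | left i => .w i
  | right i => .w (i + 1)
  | base _ => .bot

instance {n : ℕ} [NeZero n] : Finite (PolygonEdge n) :=
  Finite.of_surjective
    (fun x : (ZMod n ⊕ ZMod n) ⊕ (ZMod n ⊕ ZMod n) =>
      Sum.elim (Sum.elim top left) (Sum.elim right base) x)
    (by
      rintro (i | i | i | i)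
      · exact ⟨.inl (.inl i), rfl⟩
      · exact ⟨.inl (.inr i), rfl⟩
      · exact ⟨.inr (.inl i), rfl⟩
      · exact ⟨.inr (.inr i), rfl⟩)

end PolygonEdge

/-- The layered graph `Γ_{D_n}`, the Hasse graph of an `n`-gon (`n ≥ 2`). -/
def polygonGraph (n : ℕ) : LayeredGraph (PolygonFace n) (PolygonEdge n) where
  tail := PolygonEdge.tail
  head := PolygonEdge.head
  level := PolygonFace.level
  level_tail := by rintro (i | i | i | i) <;> rfl
  level_bounded := ⟨3, by rintro (_ | i | i | _) <;> simp [PolygonFace.level]⟩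
  bot := .bot
  level_eq_zero_iff := by rintro (_ | i | i | _) <;> simp [PolygonFace.level]
  exists_tail_eq := by
    rintro (_ | i | i | _) h
    · exact absurd rfl h
    · exact ⟨.base i, rfl⟩
    · exact ⟨.left i, rfl⟩
    · exact ⟨.top 0, rfl⟩

/-! The relations say that the product of the factors `1 + e t` along a path depends only on its
endpoints. For paths down to `*` write this product as `1 + bᵢ t` at `wᵢ`, as `1 + pᵢ t + qᵢ t²` at
`v_{i,i+1}` with `qᵢ = pᵢ bᵢ - bᵢ²`, and with linear coefficient `s` at `u`. The `bᵢ`, `pᵢ`, `s`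
span the same space as the edges, and the relations become quadratic: `qᵢ = pᵢ bᵢ₊₁ - bᵢ₊₁²`, and `s
pᵢ - pᵢ² + qᵢ` is independent of `i`. The cubic relation at `u` follows from these (`cubic_rel`).

Read as rewriting rules, they remove `pᵢ bᵢ` and `s pᵢ` for `i ≠ 0`. The overlap `s pᵢ bᵢ` yields
one further cubic rule, which removes `s p₀ bⱼ` for `j ≠ 1` (`top_mul_bot_sub`). The remaining
normal words form a basis. They span because their span is stable under left multiplication by the
generators (`gradedPiece_eq_normalSpan`). They are independent because the rules define an action of
the algebra on the space of all words in which a normal word sends the empty word to itself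
(`actRelations`, `lift_wordProd`). Counting normal words by first letter gives a linear recursion
whose characteristic polynomial is the denominator of the series. -/

/-! ### Representations of `A(Γ)` -/

namespace LayeredGraph

section Representation

open PowerSeries

variable {V E R : Type*} (Γ : LayeredGraph V E) (k : Type*) [Field k] [Ring R] [Algebra k R]

theorem pathSum_zero (π : List E) : pathSum k π 0 = 1 := by
  simp [pathSum, monomial]

theorem pathSum_nil_succ (j : ℕ) : pathSum k ([] : List E) (j + 1) = 0 := by
  simp [pathSum]

theorem pathSum_cons_succ (e : E) (π : List E) (j : ℕ) :
    pathSum k (e :: π) (j + 1) = pathSum k π (j + 1) + FreeAlgebra.ι k e * pathSum k π j := by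
  simp only [pathSum, List.sublistsLen_succ_cons, List.map_append, List.sum_append, List.map_map,
    ← List.sum_map_mul_left]
  congr 1

/-- The product `(1 + e₁ t) ⋯ (1 + eₘ t)` along a path, evaluated by `ρ`. -/
noncomputable def pathSeries (ρ : E → R) (π : List E) : R⟦X⟧ :=
  (π.map fun e => 1 + C (ρ e) * X).prod

theorem coeff_pathSeries (ρ : E → R) (π : List E) (j : ℕ) :
    coeff j (pathSeries ρ π) = FreeAlgebra.lift k ρ (pathSum k π j) := by
  induction π generalizing j with
  | nil =>
    rcases j with _ | j
    · simp [pathSeries, pathSum_zero]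
    · simp [pathSeries, pathSum_nil_succ, coeff_one]
  | cons e π ih =>
    have h : pathSeries ρ (e :: π) = pathSeries ρ π + C (ρ e) * (X * pathSeries ρ π) := by
      simp [pathSeries, add_mul, mul_assoc]
    rcases j with _ | j
    · have h0 := ih 0
      rw [pathSum_zero, map_one] at h0
      simp only [h, pathSum_zero, map_add, h0, coeff_C_mul, coeff_zero_X_mul, map_one, mul_zero,
        add_zero]
    · simp only [h, pathSum_cons_succ, map_add, ih, coeff_C_mul, coeff_succ_X_mul, map_mul,
        FreeAlgebra.lift_ι_apply]

variable {Γ} in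
-- The product telescopes along the path.
theorem pathSeries_mul {ρ : E → R} {F : V → R⟦X⟧}
    (hF : ∀ e, (1 + C (ρ e) * X) * F (Γ.head e) = F (Γ.tail e)) {v w : V} {π : List E}
    (h : Γ.IsPath v w π) : pathSeries ρ π * F w = F v := by
  induction π generalizing v with
  | nil => obtain rfl : v = w := h; simp [pathSeries]
  | cons e π ih =>
    obtain ⟨rfl, h⟩ := h
    rw [← hF, ← ih h]
    simp [pathSeries, mul_assoc]

/-- An assignment of ring elements to the edges of `Γ` extends to `A(Γ)` if every linear factor
`1 + e t` is the quotient of two power series attached to the endpoints of `e`. -/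
noncomputable def algLift (ρ : E → R) (F : V → R⟦X⟧) (hF1 : ∀ v, constantCoeff (F v) = 1)
    (hF : ∀ e, (1 + C (ρ e) * X) * F (Γ.head e) = F (Γ.tail e)) : Γ.Alg k →ₐ[k] R :=
  RingQuot.liftAlgHom k ⟨FreeAlgebra.lift k ρ, by
    rintro _ _ ⟨v, w, π₁, π₂, h₁, h₂, j, -, -⟩
    have h : pathSeries ρ π₁ = pathSeries ρ π₂ := by
      -- `F w` has constant coefficient 1, so it is invertible and can be cancelled on the right;
      -- this handles paths that end above `*`.
      have hw := mul_invOfUnit (F w) 1 (by simp [hF1])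
      rw [← mul_one (pathSeries ρ π₁), ← mul_one (pathSeries ρ π₂), ← hw, ← mul_assoc,
        ← mul_assoc, pathSeries_mul hF h₁, pathSeries_mul hF h₂]
    rw [← coeff_pathSeries, ← coeff_pathSeries, h]⟩

/-- The class of an edge in `A(Γ)`. -/
def edge (e : E) : Γ.Alg k := RingQuot.mkAlgHom k (Γ.Rel k) (FreeAlgebra.ι k e)

theorem algLift_edge (ρ : E → R) (F : V → R⟦X⟧) (hF1 : ∀ v, constantCoeff (F v) = 1)
    (hF : ∀ e, (1 + C (ρ e) * X) * F (Γ.head e) = F (Γ.tail e)) (e : E) :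
    Γ.algLift k ρ F hF1 hF (Γ.edge k e) = ρ e := by
  simp [algLift, edge]

end Representation

/-! ### Graded pieces as powers of the span of the edges -/

section GradedPiece

variable {V E : Type*} (Γ : LayeredGraph V E) (k : Type*) [Field k]

open scoped Pointwise in
theorem tensorDegree_eq_pow (i : ℕ) :
    tensorDegree k E i = Submodule.span k (Set.range (FreeAlgebra.ι k)) ^ i := by
  rw [Submodule.span_pow, tensorDegree]
  congr 1
  induction i with
  | zero =>
    ext x
    simp [monomial, List.length_eq_zero_iff, eq_comm (a := x)]
  | succ i ih =>
    rw [pow_succ', ← ih]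
    ext x
    simp only [Set.mem_image, Set.mem_ofPred_eq, Set.mem_mul, Set.mem_range]
    constructor
    · rintro ⟨_ | ⟨e, π⟩, hπ, rfl⟩
      · simp at hπ
      · exact ⟨_, ⟨e, rfl⟩, _, ⟨π, by simpa using hπ, rfl⟩, by simp [monomial]⟩
    · rintro ⟨_, ⟨e, rfl⟩, _, ⟨π, hπ, rfl⟩, rfl⟩
      exact ⟨e :: π, by simpa using hπ, by simp [monomial]⟩

/-- In this form the grading depends only on the span of the edges, so the edges may be exchanged
for other generators. -/
theorem gradedPiece_eq_pow (i : ℕ) :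
    Γ.gradedPiece k i = Submodule.span k (Set.range (Γ.edge k)) ^ i := by
  rw [gradedPiece, tensorDegree_eq_pow, Submodule.map_pow, Submodule.map_span, ← Set.range_comp]
  rfl

end GradedPiece

end LayeredGraph

/-! ### Representations of `A(Γ_{D_n})` in terms of three families of elements -/

/-- The relations of `A(Γ_{D_n})` in the generators `bᵢ = (wᵢ → *)`,
`pᵢ = (v_{i,i+1} → wᵢ) + (wᵢ → *)` and `s = (u → v_{i,i+1}) + pᵢ`. -/
structure PolygonRelations {R : Type*} [Ring R] {n : ℕ} (b p : ZMod n → R) (s : R) : Prop where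
  face_rel : ∀ i, p i * b i - b i * b i = p i * b (i + 1) - b (i + 1) * b (i + 1)
  top_rel : ∀ i, s * p i - p i * p i + (p i * b i - b i * b i) =
    s * p 0 - p 0 * p 0 + (p 0 * b 0 - b 0 * b 0)

theorem ZMod.eq_of_eq_succ {α : Type*} {n : ℕ} [NeZero n] {f : ZMod n → α}
    (h : ∀ i, f i = f (i + 1)) (i j : ZMod n) : f i = f j := by
  have h0 : ∀ m : ℕ, f (m : ZMod n) = f 0 := by
    intro m
    induction m with
    | zero => simp
    | succ m ih => rw [Nat.cast_succ, ← h, ih]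
  rw [← ZMod.natCast_zmod_val i, ← ZMod.natCast_zmod_val j, h0, h0]

namespace PolygonRelations

variable {R : Type*} [Ring R] {n : ℕ} {b p : ZMod n → R} {s : R}

/-- With `qᵢ = pᵢ bᵢ - bᵢ²`, the hypothesis reads `pᵢ (bᵢ - bᵢ₊₁) = bᵢ² - bᵢ₊₁²`. Multiply by `pᵢ`
on the left and replace `pᵢ bᵢ` by `qᵢ + bᵢ²` and `pᵢ bᵢ₊₁` by `qᵢ + bᵢ₊₁²`. No relation involving
`s` enters, so the identity is available before `s` is known to act compatibly. -/
theorem cube_sub (h : ∀ i, p i * b i - b i * b i = p i * b (i + 1) - b (i + 1) * b (i + 1))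
    (i : ZMod n) : (p i * p i - (p i * b i - b i * b i)) * (b i - b (i + 1)) =
      b i * b i * b i - b (i + 1) * b (i + 1) * b (i + 1) := by
  have h1 : p i * (b i - b (i + 1)) = b i * b i - b (i + 1) * b (i + 1) := by
    rw [mul_sub, sub_eq_sub_iff_add_eq_add, add_comm (b i * b i), ← sub_eq_sub_iff_add_eq_add, h i]
  calc _ = p i * (p i * (b i - b (i + 1))) - (p i * b i - b i * b i) * b i
        + (p i * b i - b i * b i) * b (i + 1) := by noncomm_ring
    _ = _ := by rw [h1, h i, ← h i]; nth_rw 2 [h i]; noncomm_ring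

/-- This and `top_rel'` orient the defining relations as rewriting rules. -/
theorem face_rel' (h : PolygonRelations b p s) (i : ZMod n) :
    p i * b i = p i * b (i + 1) + (b i * b i - b (i + 1) * b (i + 1)) := by
  have h1 := h.face_rel i
  grind

theorem top_rel' (h : PolygonRelations b p s) (i : ZMod n) :
    s * p i = s * p 0 + (p i * p i - (p i * b i - b i * b i)
      - (p 0 * p 0 - (p 0 * b 0 - b 0 * b 0))) := by
  have h1 := h.top_rel i
  grind

/-- The quadratic relations at the top imply the equality of the cubic coefficients. -/
theorem cubic_rel [NeZero n] (h : PolygonRelations b p s) (i j : ZMod n) :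
    (s - p i) * (p i * b i - b i * b i) = (s - p j) * (p j * b j - b j * b j) := by
  refine ZMod.eq_of_eq_succ (f := fun i => (s - p i) * (p i * b i - b i * b i)) (fun i => ?_) i j
  have h1 := h.face_rel i
  have h2 := (h.top_rel i).trans (h.top_rel (i + 1)).symm
  have h3 : (s * p i - p i * p i + (p i * b i - b i * b i)) * b (i + 1) =
    (s * p (i + 1) - p (i + 1) * p (i + 1) +
      (p (i + 1) * b (i + 1) - b (i + 1) * b (i + 1))) * b (i + 1) := by rw [h2]
  have h4 : (s - p i) * (p i * b i - b i * b i) =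
    (s - p i) * (p i * b (i + 1) - b (i + 1) * b (i + 1)) := by rw [h1]
  rw [h1] at h3
  simp only [h4]
  clear h4 h1 h2
  simp only [mul_sub, sub_mul, add_mul, mul_assoc] at h3 ⊢
  rw [← sub_eq_zero] at h3 ⊢
  rw [← h3]
  abel

/-- Resolution of the overlap `s pᵢ bᵢ`: evaluate `s pᵢ (bᵢ - bᵢ₊₁)` once by the face relation and
once by rewriting `s pᵢ` through `s p₀`. By `cube_sub` the terms in `pᵢ` disappear, and what remains
compares neighbouring indices. -/
theorem top_mul_bot_sub [NeZero n] (h : PolygonRelations b p s) (i j : ZMod n) :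
    s * (p 0 * b i) = s * (p 0 * b j) +
      ((s * b i * b i - b i * b i * b i + (p 0 * p 0 - (p 0 * b 0 - b 0 * b 0)) * b i) -
        (s * b j * b j - b j * b j * b j + (p 0 * p 0 - (p 0 * b 0 - b 0 * b 0)) * b j)) := by
  have key := ZMod.eq_of_eq_succ (f := fun i => s * (p 0 * b i) -
    (s * b i * b i - b i * b i * b i + (p 0 * p 0 - (p 0 * b 0 - b 0 * b 0)) * b i)) (fun i => ?_)
    i j
  · rw [← sub_eq_zero] at key ⊢
    rw [← key]
    abel
  have h1 := cube_sub h.face_rel i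
  have h2 : s * p i * (b i - b (i + 1)) = (s * p 0 + (p i * p i - (p i * b i - b i * b i)
      - (p 0 * p 0 - (p 0 * b 0 - b 0 * b 0)))) * (b i - b (i + 1)) := by rw [h.top_rel' i]
  have h3 : s * (p i * b i) = s * (p i * b (i + 1) + (b i * b i - b (i + 1) * b (i + 1))) := by
    rw [h.face_rel' i]
  rw [add_mul, sub_mul (p i * p i - _), h1] at h2
  simp only [mul_sub, sub_mul, mul_add, mul_assoc] at h3 h2 ⊢
  rw [h3, ← sub_eq_zero] at h2
  rw [← sub_eq_zero, ← neg_eq_zero, ← h2]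
  abel

end PolygonRelations

namespace polygonGraph

open LayeredGraph PolygonEdge

/-! ### The generators `bᵢ`, `pᵢ`, `s` and their relations in the algebra -/

section Generators

variable (k : Type*) [Field k] (n : ℕ)

/-- The generator `bᵢ` of `A(Γ_{D_n})`. -/
def genB (i : ZMod n) : (polygonGraph n).Alg k := (polygonGraph n).edge k (base i)

/-- The generator `pᵢ` of `A(Γ_{D_n})`. -/
def genP (i : ZMod n) : (polygonGraph n).Alg k :=
  (polygonGraph n).edge k (left i) + (polygonGraph n).edge k (base i)

/-- The generator `s` of `A(Γ_{D_n})`. -/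
def genS : (polygonGraph n).Alg k := (polygonGraph n).edge k (top 0) + genP k n 0

variable {n}

theorem mkAlgHom_pathSum_eq {v w : PolygonFace n} {π₁ π₂ : List (PolygonEdge n)}
    (h₁ : (polygonGraph n).IsPath v w π₁) (h₂ : (polygonGraph n).IsPath v w π₂) (j : ℕ)
    (hj : 1 ≤ j) (hj' : j ≤ π₁.length) :
    RingQuot.mkAlgHom k ((polygonGraph n).Rel k) (pathSum k π₁ j) =
      RingQuot.mkAlgHom k ((polygonGraph n).Rel k) (pathSum k π₂ j) :=
  RingQuot.mkAlgHom_rel k (.intro v w π₁ π₂ h₁ h₂ j hj hj')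

theorem edge_right (i : ZMod n) :
    (polygonGraph n).edge k (right i) = genP k n i - genB k n (i + 1) := by
  have h := mkAlgHom_pathSum_eq k (n := n) (v := .v i) (w := .bot) (π₁ := [left i, base i])
    (π₂ := [right i, base (i + 1)]) ⟨rfl, rfl, rfl⟩ ⟨rfl, rfl, rfl⟩ 1 le_rfl (by simp)
  simp only [pathSum_cons_succ, pathSum_nil_succ, pathSum_zero, map_add, mul_one,
    zero_add] at h
  rw [genP, genB, eq_sub_iff_add_eq, add_comm, edge, edge, edge, edge, ← h, add_comm]

theorem edge_left (i : ZMod n) :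
    (polygonGraph n).edge k (left i) = genP k n i - genB k n i := by
  simp [genP, genB]

theorem edge_top (i : ZMod n) :
    (polygonGraph n).edge k (top i) = genS k n - genP k n i := by
  have h := mkAlgHom_pathSum_eq k (n := n) (v := .u) (w := .bot) (π₁ := [top i, left i, base i])
    (π₂ := [top 0, left 0, base 0]) ⟨rfl, rfl, rfl, rfl⟩ ⟨rfl, rfl, rfl, rfl⟩ 1 le_rfl (by simp)
  simp only [pathSum_cons_succ, pathSum_nil_succ, pathSum_zero, map_add, mul_one,
    zero_add] at h
  rw [eq_sub_iff_add_eq]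
  simp only [genS, genP, edge]
  rw [add_comm (RingQuot.mkAlgHom _ _ (FreeAlgebra.ι k (left i))), add_comm, h]
  abel

/-- The linear path relations went into expressing the edges by the new generators; these are the
path relations with `j = 2`. -/
theorem polygonRelations : PolygonRelations (genB k n) (genP k n) (genS k n) where
  face_rel i := by
    have h := mkAlgHom_pathSum_eq k (n := n) (v := .v i) (w := .bot) (π₁ := [left i, base i])
      (π₂ := [right i, base (i + 1)]) ⟨rfl, rfl, rfl⟩ ⟨rfl, rfl, rfl⟩ 2 (by simp) (by simp)
    simp only [pathSum_cons_succ, pathSum_nil_succ, pathSum_zero, map_mul, mul_one, zero_add,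
      mul_zero, add_zero] at h
    simp only [← edge.eq_1, edge_left, edge_right] at h
    simpa only [← genB.eq_1, sub_mul] using h
  top_rel i := by
    have h := mkAlgHom_pathSum_eq k (n := n) (v := .u) (w := .bot)
      (π₁ := [top i, left i, base i]) (π₂ := [top 0, left 0, base 0])
      ⟨rfl, rfl, rfl, rfl⟩ ⟨rfl, rfl, rfl, rfl⟩ 2 (by simp) (by simp)
    simp only [pathSum_cons_succ, pathSum_nil_succ, pathSum_zero, map_add, map_mul,
      mul_one, zero_add, mul_zero, add_zero] at h
    simp only [← edge.eq_1, edge_left, edge_top] at h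
    simp only [← genB.eq_1, sub_mul, add_sub_cancel] at h
    rw [add_comm, h, add_comm]

theorem span_edge : Submodule.span k (Set.range ((polygonGraph n).edge k)) =
    Submodule.span k (Set.range (genB k n) ∪ Set.range (genP k n) ∪ {genS k n}) := by
  apply le_antisymm <;> rw [Submodule.span_le]
  · have hb (i) : genB k n i ∈
        Submodule.span k (Set.range (genB k n) ∪ Set.range (genP k n) ∪ {genS k n}) :=
      Submodule.subset_span (by simp)
    have hp (i) : genP k n i ∈
        Submodule.span k (Set.range (genB k n) ∪ Set.range (genP k n) ∪ {genS k n}) :=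
      Submodule.subset_span (by simp)
    have hs : genS k n ∈
        Submodule.span k (Set.range (genB k n) ∪ Set.range (genP k n) ∪ {genS k n}) :=
      Submodule.subset_span (by simp)
    rintro _ ⟨i | i | i | i, rfl⟩
    · rw [edge_top]; exact sub_mem hs (hp i)
    · rw [edge_left]; exact sub_mem (hp i) (hb i)
    · rw [edge_right]; exact sub_mem (hp i) (hb _)
    · exact hb i
  · have he (e) : (polygonGraph n).edge k e ∈
        Submodule.span k (Set.range ((polygonGraph n).edge k)) :=
      Submodule.subset_span ⟨e, rfl⟩
    rintro _ ((⟨i, rfl⟩ | ⟨i, rfl⟩) | rfl)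
    · exact he _
    · exact add_mem (he _) (he _)
    · exact add_mem (he _) (add_mem (he _) (he _))

end Generators

/-! ### The universal property of the presentation -/

section Lift

open PowerSeries

variable (k : Type*) [Field k] {n : ℕ} {R : Type*} [Ring R] [Algebra k R]

/-- The images of the edges under the map attached to `b`, `p`, `s`. -/
def edgeImage (b p : ZMod n → R) (s : R) : PolygonEdge n → R
  | top i => s - p i
  | left i => p i - b i
  | right i => p i - b (i + 1)
  | base i => b i

/-- The power series (in fact polynomials) attached to the faces. -/
noncomputable def faceSeries (b p : ZMod n → R) (s : R) : PolygonFace n → R⟦X⟧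
  | .bot => 1
  | .w i => 1 + C (b i) * X
  | .v i => 1 + C (p i) * X + C (p i * b i - b i * b i) * X ^ 2
  | .u => 1 + C s * X + C (s * p 0 - p 0 * p 0 + (p 0 * b 0 - b 0 * b 0)) * X ^ 2
    + C ((s - p 0) * (p 0 * b 0 - b 0 * b 0)) * X ^ 3

theorem constantCoeff_faceSeries (b p : ZMod n → R) (s : R) (v : PolygonFace n) :
    constantCoeff (faceSeries b p s v) = 1 := by
  cases v <;> simp [faceSeries]

theorem one_add_mul_quadratic (e x y : R) :
    (1 + C e * X) * (1 + C x * X + C y * X ^ 2) =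
      1 + C (e + x) * X + C (e * x + y) * X ^ 2 + C (e * y) * X ^ 3 := by
  have h1 (z : R) : C e * X * C z = C (e * z) * X := by
    rw [mul_assoc, X_mul, ← mul_assoc, map_mul]
  rw [add_mul, mul_add (C e * X), mul_add (C e * X), ← mul_assoc (C e * X) (C x),
    ← mul_assoc (C e * X) (C y), h1, h1]
  simp only [add_mul, map_add, mul_assoc, mul_one, one_mul, pow_succ', pow_zero]
  abel

theorem one_add_mul_linear (e x : R) :
    (1 + C e * X) * (1 + C x * X) = 1 + C (e + x) * X + C (e * x) * X ^ 2 := by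
  simpa using one_add_mul_quadratic e x 0

/-- For the edges out of `u` the coefficient of `X ^ 3` matches by `cubic_rel`; all others match by
the given relations. -/
theorem mul_faceSeries [NeZero n] {b p : ZMod n → R} {s : R} (h : PolygonRelations b p s)
    (e : PolygonEdge n) :
    (1 + C (edgeImage b p s e) * X) * faceSeries b p s ((polygonGraph n).head e) =
      faceSeries b p s ((polygonGraph n).tail e) := by
  rcases e with i | i | i | i <;>
    simp only [edgeImage, faceSeries, polygonGraph, PolygonEdge.head, PolygonEdge.tail]
  · rw [one_add_mul_quadratic, ← h.top_rel i, h.cubic_rel i 0, sub_add_cancel, sub_mul]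
  · rw [one_add_mul_linear, sub_add_cancel, sub_mul]
  · rw [one_add_mul_linear, sub_add_cancel, sub_mul, h.face_rel]
  · rw [mul_one]

/-- The homomorphism from `A(Γ_{D_n})` given by elements that satisfy the relations. -/
noncomputable def lift [NeZero n] {b p : ZMod n → R} {s : R} (h : PolygonRelations b p s) :
    (polygonGraph n).Alg k →ₐ[k] R :=
  (polygonGraph n).algLift k (edgeImage b p s) (faceSeries b p s)
    (constantCoeff_faceSeries b p s) (mul_faceSeries h)

variable [NeZero n] {b p : ZMod n → R} {s : R} (h : PolygonRelations b p s)

theorem lift_genB (i : ZMod n) : lift k h (genB k n i) = b i :=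
  algLift_edge ..

theorem lift_genP (i : ZMod n) : lift k h (genP k n i) = p i := by
  rw [genP, map_add, lift, algLift_edge, algLift_edge, edgeImage, edgeImage, sub_add_cancel]

theorem lift_genS : lift k h (genS k n) = s := by
  rw [genS, map_add, lift_genP, lift, algLift_edge, edgeImage, sub_add_cancel]

end Lift

end polygonGraph

/-! ### Normal words -/

/-- Letters for the generators `bᵢ`, `pᵢ`, `s` of `A(Γ_{D_n})`. -/
inductive PolygonLetter (n : ℕ) : Type
  | b (i : ZMod n) : PolygonLetter n
  | p (i : ZMod n) : PolygonLetter n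
  | s : PolygonLetter n

namespace PolygonLetter

variable {n : ℕ}

/-- `Allowed x w`: the letter `x` can be put in front of the normal word `w`. The excluded
beginnings are `pᵢ bᵢ`, `s pᵢ` for `i ≠ 0` and `s p₀ bⱼ` for `j ≠ 1`. -/
def Allowed : PolygonLetter n → List (PolygonLetter n) → Prop
  | p i, b j :: _ => j ≠ i
  | s, p i :: b j :: _ => i = 0 ∧ j = 1
  | s, p i :: _ => i = 0
  | _, _ => True

/-- Words all of whose tails begin in an allowed way. -/
def Normal : List (PolygonLetter n) → Prop
  | [] => True
  | x :: w => Allowed x w ∧ Normal w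

theorem allowed_b (i : ZMod n) (w : List (PolygonLetter n)) : Allowed (b i) w := trivial

theorem not_allowed_p_iff {i : ZMod n} {w : List (PolygonLetter n)} :
    ¬ Allowed (p i) w ↔ ∃ w', w = b i :: w' := by
  rcases w with _ | ⟨_ | _ | _, w⟩ <;> simp [Allowed]

/-- Normality of `w` already rules out the beginning `p₀ b₀`, hence `j ≠ 0`; this keeps the count of
exclusions free of overlaps. -/
theorem not_allowed_s_iff {w : List (PolygonLetter n)} (hw : Normal w) :
    ¬ Allowed s w ↔ (∃ i, i ≠ 0 ∧ ∃ w', w = p i :: w') ∨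
      ∃ j, (j ≠ 0 ∧ j ≠ 1) ∧ ∃ w', w = p 0 :: b j :: w' := by
  rcases w with _ | ⟨_ | i | _, _ | ⟨j | _ | _, w⟩⟩ <;> simp [Allowed, Normal] at hw ⊢
  by_cases hi : i = 0
  · subst hi; simp [hw]
  · simp [hi]

/-- The finset of words of length `m`. -/
noncomputable def words (n : ℕ) [NeZero n] (m : ℕ) : Finset (List (PolygonLetter n)) :=
  have : Finite (PolygonLetter n) := Finite.of_surjective
    (fun x : (ZMod n ⊕ ZMod n) ⊕ Unit => Sum.elim (Sum.elim b p) (fun _ => s) x) (by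
      rintro (i | i | _)
      exacts [⟨.inl (.inl i), rfl⟩, ⟨.inl (.inr i), rfl⟩, ⟨.inr (), rfl⟩])
  (List.finite_length_eq (PolygonLetter n) m).toFinset

open Classical in
/-- The finset of normal words of length `m`. -/
noncomputable def normalWords (n : ℕ) [NeZero n] (m : ℕ) : Finset (List (PolygonLetter n)) :=
  (words n m).filter Normal

variable [NeZero n]

theorem mem_normalWords {m : ℕ} {w : List (PolygonLetter n)} :
    w ∈ normalWords n m ↔ w.length = m ∧ Normal w := by
  simp [normalWords, words]

open Classical in
/-- The normal words of length `m` that can be extended by `x`. -/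
noncomputable def extendable (x : PolygonLetter n) (m : ℕ) : Finset (List (PolygonLetter n)) :=
  (normalWords n m).filter (Allowed x)

theorem mem_extendable {x : PolygonLetter n} {m : ℕ} {w : List (PolygonLetter n)} :
    w ∈ extendable x m ↔ x :: w ∈ normalWords n (m + 1) := by
  simp [extendable, mem_normalWords, Normal]
  tauto

theorem card_normalWords_zero : (normalWords n 0).card = 1 := by
  rw [Finset.card_eq_one]
  refine ⟨[], ?_⟩
  ext w
  rw [mem_normalWords, List.length_eq_zero_iff, Finset.mem_singleton]
  exact ⟨fun h => h.1, fun h => ⟨h, h ▸ trivial⟩⟩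

omit [NeZero n] in
theorem card_biUnion_cons {ι : Type*} (I : Finset ι) {f : ι → List (PolygonLetter n)}
    (hf : Function.Injective f) (hlen : ∀ i j, (f i).length = (f j).length)
    (t : ι → Finset (List (PolygonLetter n))) [DecidableEq (List (PolygonLetter n))] :
    (I.biUnion fun i => (t i).image (f i ++ ·)).card = ∑ i ∈ I, (t i).card := by
  rw [Finset.card_biUnion]
  · exact Finset.sum_congr rfl fun i _ =>
      Finset.card_image_of_injective _ (List.append_right_injective _)
  · intro i _ j _ hij
    simp only [Function.onFun, Finset.disjoint_left, Finset.mem_image]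
    rintro _ ⟨w, -, rfl⟩ ⟨w', -, h⟩
    exact hij (hf (List.append_inj_left h (hlen _ _)).symm)

theorem card_normalWords_succ (m : ℕ) : (normalWords n (m + 1)).card =
    n * (normalWords n m).card + (∑ i : ZMod n, (extendable (p i) m).card)
      + (extendable (s : PolygonLetter n) m).card := by
  classical
  have h : normalWords n (m + 1) =
      ((Finset.univ.biUnion fun i : ZMod n => (normalWords n m).image ([b i] ++ ·)) ∪
      (Finset.univ.biUnion fun i : ZMod n => (extendable (p i) m).image ([p i] ++ ·))) ∪
      (extendable s m).image ([s] ++ ·) := by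
    ext w
    rcases w with _ | ⟨i | i | _, w⟩ <;>
      simp [mem_extendable, mem_normalWords, Normal, allowed_b]
  rw [h, Finset.card_union_of_disjoint, Finset.card_union_of_disjoint,
    card_biUnion_cons _ (fun i j h => by simpa using h) (fun _ _ => rfl),
    card_biUnion_cons _ (fun i j h => by simpa using h) (fun _ _ => rfl),
    Finset.card_image_of_injective _ (List.append_right_injective _)]
  · simp
  · rw [Finset.disjoint_left]
    rintro (_ | ⟨i | i | _, w⟩) <;> simp
  · rw [Finset.disjoint_left]
    rintro (_ | ⟨i | i | _, w⟩) <;> simp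

theorem card_extendable_p_zero (i : ZMod n) : (extendable (p i) 0).card = 1 := by
  classical
  rw [← card_normalWords_zero (n := n), extendable, Finset.filter_true_of_mem]
  intro w hw
  rw [mem_normalWords, List.length_eq_zero_iff] at hw
  rw [hw.1]
  trivial

/-- The words lost are `bᵢ w'` with `w'` an arbitrary normal word, since `bᵢ` can precede anything.
-/
theorem card_extendable_p (i : ZMod n) (m : ℕ) :
    (extendable (p i) (m + 1)).card + (normalWords n m).card = (normalWords n (m + 1)).card := by
  classical
  rw [← Finset.card_filter_add_card_filter_not (s := normalWords n (m + 1)) (Allowed (p i)),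
    extendable]
  congr 1
  have : (normalWords n (m + 1)).filter (fun w => ¬ Allowed (p i) w) =
      (normalWords n m).image ([b i] ++ ·) := by
    ext w
    simp only [Finset.mem_filter, not_allowed_p_iff, Finset.mem_image, mem_normalWords]
    constructor
    · rintro ⟨⟨h1, h2⟩, w', rfl⟩
      exact ⟨w', ⟨by simpa using h1, h2.2⟩, rfl⟩
    · rintro ⟨w', ⟨h1, h2⟩, rfl⟩
      exact ⟨⟨by simpa using h1, trivial, h2⟩, w', rfl⟩
  rw [this, Finset.card_image_of_injective _ (List.append_right_injective _)]

theorem card_extendable_s_zero : (extendable (s : PolygonLetter n) 0).card = 1 := by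
  classical
  rw [← card_normalWords_zero (n := n), extendable, Finset.filter_true_of_mem]
  intro w hw
  rw [mem_normalWords, List.length_eq_zero_iff] at hw
  rw [hw.1]
  trivial

/-- After the prefix `p₀ bⱼ` there remain `m - 1` letters; for `m = 0` no such word exists, and the
`if` guards against truncated subtraction. -/
theorem card_extendable_s (m : ℕ) :
    (extendable (s : PolygonLetter n) (m + 1)).card +
      (∑ i ∈ ({i : ZMod n | i ≠ 0} : Finset (ZMod n)), (extendable (p i) m).card) +
      (∑ _j ∈ ({j : ZMod n | j ≠ 0 ∧ j ≠ 1} : Finset (ZMod n)),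
        if m = 0 then 0 else (normalWords n (m - 1)).card) = (normalWords n (m + 1)).card := by
  classical
  rw [← Finset.card_filter_add_card_filter_not (s := normalWords n (m + 1)) (Allowed s),
    extendable, add_assoc]
  congr 1
  have : (normalWords n (m + 1)).filter (fun w => ¬ Allowed s w) =
      (({i : ZMod n | i ≠ 0} : Finset (ZMod n)).biUnion
        fun i => (extendable (p i) m).image ([p i] ++ ·)) ∪
      ({j : ZMod n | j ≠ 0 ∧ j ≠ 1} : Finset (ZMod n)).biUnion
        fun j => (if m = 0 then ∅ else normalWords n (m - 1)).image ([p 0, b j] ++ ·) := by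
    ext w
    rw [Finset.mem_filter, and_congr_right fun h => not_allowed_s_iff (mem_normalWords.1 h).2,
      Finset.mem_union]
    simp only [Finset.mem_biUnion, Finset.mem_image, Finset.mem_filter, Finset.mem_univ, true_and,
      mem_extendable]
    constructor
    · rintro ⟨hw, ⟨i, hi, w', rfl⟩ | ⟨j, hj, w', rfl⟩⟩
      · exact .inl ⟨i, hi, w', hw, rfl⟩
      · obtain ⟨h1, h2⟩ := mem_normalWords.1 hw
        obtain ⟨m, rfl⟩ : ∃ m', m = m' + 1 := ⟨w'.length, by simpa using h1.symm⟩
        refine .inr ⟨j, hj, w', ?_, rfl⟩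
        simpa [mem_normalWords] using ⟨by simpa using h1, h2.2.2⟩
    · rintro (⟨i, hi, w', hw, rfl⟩ | ⟨j, hj, w', hw, rfl⟩)
      · exact ⟨hw, .inl ⟨i, hi, w', rfl⟩⟩
      · rcases m with _ | m
        · simp at hw
        · simp only [Nat.add_eq_zero_iff, one_ne_zero, and_false, if_false, Nat.add_sub_cancel,
            mem_normalWords] at hw
          exact ⟨mem_normalWords.2 ⟨by simp [hw.1], hj.1, trivial, hw.2⟩, .inr ⟨j, hj, w', rfl⟩⟩
  rw [this, Finset.card_union_of_disjoint,
    card_biUnion_cons _ (fun i j h => by simpa using h) (fun _ _ => rfl),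
    card_biUnion_cons _ (fun i j h => by simpa using h) (fun _ _ => rfl)]
  · split_ifs <;> simp
  · rw [Finset.disjoint_left]
    rintro w h1 h2
    simp only [Finset.mem_biUnion, Finset.mem_image, Finset.mem_filter, Finset.mem_univ,
      true_and] at h1 h2
    obtain ⟨i, hi, w', -, rfl⟩ := h1
    obtain ⟨j, hj, w', -, h⟩ := h2
    simp only [List.cons_append, List.nil_append, List.cons.injEq, p.injEq] at h
    exact hi h.1.symm

theorem card_normalWords_one : ((normalWords n 1).card : ℤ) = 2 * n + 1 := by
  rw [card_normalWords_succ, card_normalWords_zero, card_extendable_s_zero]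
  simp only [card_extendable_p_zero]
  simp
  ring

/-! ### The recursion for the number of normal words -/

section Counting

variable (hn : 2 ≤ n)
include hn

theorem card_ne_zero : (({i : ZMod n | i ≠ 0} : Finset (ZMod n)).card : ℤ) = n - 1 := by
  classical
  rw [Finset.filter_ne' Finset.univ 0, Finset.card_erase_of_mem (Finset.mem_univ _),
    Finset.card_univ, ZMod.card, Nat.cast_sub (by lia), Nat.cast_one]

theorem card_ne_zero_one :
    (({j : ZMod n | j ≠ 0 ∧ j ≠ 1} : Finset (ZMod n)).card : ℤ) = n - 2 := by
  classical
  have : Fact (1 < n) := ⟨hn⟩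
  have h : ({j : ZMod n | j ≠ 0 ∧ j ≠ 1} : Finset (ZMod n)) = (Finset.univ.erase 0).erase 1 := by
    ext; simp [and_comm]
  rw [h, Finset.card_erase_of_mem (by simp), Finset.card_erase_of_mem (Finset.mem_univ _),
    Finset.card_univ, ZMod.card, Nat.sub_sub, Nat.cast_sub hn]
  rfl

theorem card_normalWords_two :
    ((normalWords n 2).card : ℤ) = (2 * n + 1) * (2 * n + 1) - (2 * n - 1) := by
  have h0 := card_normalWords_zero (n := n)
  have h1 := card_normalWords_one (n := n)
  have hs := card_extendable_s (n := n) 0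
  simp only [card_extendable_p_zero, if_true, Finset.sum_const, smul_eq_mul, mul_one, mul_zero,
    add_zero, zero_add] at hs
  have hp (i : ZMod n) : ((extendable (p i) 1).card : ℤ) = 2 * n := by
    have := card_extendable_p i 0
    zify [h0] at this
    lia
  have hc := card_ne_zero hn
  rw [card_normalWords_succ]
  push_cast
  simp only [hp]
  zify at hs
  simp only [Finset.sum_const, Finset.card_univ, ZMod.card, nsmul_eq_mul]
  linear_combination (n + 1 : ℤ) * h1 + hs - hc

/-- With `h` the count, the letters `b`, `p`, `s` contribute `n h(m+2)`, `n (h(m+2) - h(m+1))` and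
`h(m+2) - (n-1)(h(m+1) - h(m)) - (n-2) h(m)`. -/
theorem card_normalWords_add_three (m : ℕ) : ((normalWords n (m + 3)).card : ℤ) =
    (2 * n + 1) * (normalWords n (m + 2)).card - (2 * n - 1) * (normalWords n (m + 1)).card
      + (normalWords n m).card := by
  have hs := card_extendable_s (n := n) (m + 1)
  simp only [if_neg m.succ_ne_zero] at hs
  have hp (i : ZMod n) (m : ℕ) : ((extendable (p i) (m + 1)).card : ℤ) =
      (normalWords n (m + 1)).card - (normalWords n m).card := by
    rw [← card_extendable_p i m]; push_cast; ring
  have hc := card_ne_zero hn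
  have hc' := card_ne_zero_one hn
  rw [card_normalWords_succ]
  zify at hs
  push_cast
  simp only [hp, Finset.sum_const, Finset.card_univ, ZMod.card, nsmul_eq_mul,
    Nat.add_sub_cancel, hc, hc'] at hs ⊢
  linear_combination hs

end Counting

end PolygonLetter

/-! ### The action of `A(Γ_{D_n})` on the space of words -/

namespace PolygonLetter

section Action

variable (k : Type*) [Field k] {n : ℕ}

/-- A word as a basis vector of the space of words. -/
noncomputable abbrev vec (w : List (PolygonLetter n)) : List (PolygonLetter n) →₀ k :=
  Finsupp.single w 1

/-- The endomorphism of the space of words with prescribed values on words. -/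
noncomputable def endOfFun
    (f : List (PolygonLetter n) → List (PolygonLetter n) →₀ k) :
    Module.End k (List (PolygonLetter n) →₀ k) :=
  Finsupp.linearCombination k f

theorem endOfFun_vec (f : List (PolygonLetter n) → List (PolygonLetter n) →₀ k)
    (w : List (PolygonLetter n)) : endOfFun k f (vec k w) = f w := by
  simp [endOfFun]

theorem end_ext {f g : Module.End k (List (PolygonLetter n) →₀ k)}
    (h : ∀ w, f (vec k w) = g (vec k w)) : f = g :=
  Finsupp.lhom_ext' fun w => LinearMap.ext_ring (h w)

/-- The action of `bᵢ` on words. -/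
noncomputable def actB (i : ZMod n) : Module.End k (List (PolygonLetter n) →₀ k) :=
  endOfFun k fun w => vec k (b i :: w)

/-- The value of `pᵢ` on words: `pᵢ bᵢ` is rewritten as `pᵢ bᵢ₊₁ + bᵢ² - bᵢ₊₁²`. -/
noncomputable def funP (i : ZMod n) : List (PolygonLetter n) → List (PolygonLetter n) →₀ k
  | b j :: w => if j = i then
      vec k (p i :: b (i + 1) :: w) + (vec k (b i :: b i :: w) - vec k (b (i + 1) :: b (i + 1) :: w))
      else vec k (p i :: b j :: w)
  | w => vec k (p i :: w)

/-- The action of `pᵢ` on words. -/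
noncomputable def actP (i : ZMod n) : Module.End k (List (PolygonLetter n) →₀ k) :=
  endOfFun k (funP k i)

/-- The action of `pᵢ² - qᵢ`, where `qᵢ = pᵢ bᵢ - bᵢ²`. -/
noncomputable def actQuad (i : ZMod n) : Module.End k (List (PolygonLetter n) →₀ k) :=
  actP k i * actP k i - (actP k i * actB k i - actB k i * actB k i)

/-- The value of `s p₀` on words: `s p₀ bⱼ` is rewritten in terms of `s p₀ b₁`. -/
noncomputable def funSP : List (PolygonLetter n) → List (PolygonLetter n) →₀ k
  | b j :: w => vec k (s :: p 0 :: b 1 :: w) +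
      ((vec k (s :: b j :: b j :: w) - actB k j (actB k j (actB k j (vec k w))) +
          actQuad k 0 (actB k j (vec k w))) -
        (vec k (s :: b 1 :: b 1 :: w) - actB k 1 (actB k 1 (actB k 1 (vec k w))) +
          actQuad k 0 (actB k 1 (vec k w))))
  | w => vec k (s :: p 0 :: w)

/-- The value of `s` on words: `s pᵢ` is rewritten in terms of `s p₀`. -/
noncomputable def funS : List (PolygonLetter n) → List (PolygonLetter n) →₀ k
  | p i :: w => funSP k w + (actQuad k i (vec k w) - actQuad k 0 (vec k w))
  | w => vec k (s :: w)

/-- The action of `s` on words. -/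
noncomputable def actS : Module.End k (List (PolygonLetter n) →₀ k) :=
  endOfFun k (funS k)

theorem actB_vec (i : ZMod n) (w : List (PolygonLetter n)) :
    actB k i (vec k w) = vec k (b i :: w) :=
  endOfFun_vec ..

theorem actP_vec_of_allowed {i : ZMod n} {w : List (PolygonLetter n)} (h : Allowed (p i) w) :
    actP k i (vec k w) = vec k (p i :: w) := by
  rw [actP, endOfFun_vec]
  rcases w with _ | ⟨j | _ | _, w⟩
  · rfl
  · exact if_neg h
  · rfl
  · rfl

theorem actP_vec_b (i : ZMod n) (w : List (PolygonLetter n)) :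
    actP k i (vec k (b i :: w)) = vec k (p i :: b (i + 1) :: w) +
      (vec k (b i :: b i :: w) - vec k (b (i + 1) :: b (i + 1) :: w)) := by
  rw [actP, endOfFun_vec]
  exact if_pos rfl

theorem actS_vec_p (i : ZMod n) (w : List (PolygonLetter n)) :
    actS k (vec k (p i :: w)) =
      funSP k w + (actQuad k i (vec k w) - actQuad k 0 (vec k w)) :=
  endOfFun_vec ..

theorem actS_vec_b (i : ZMod n) (w : List (PolygonLetter n)) :
    actS k (vec k (b i :: w)) = vec k (s :: b i :: w) :=
  endOfFun_vec ..

theorem actS_vec_of_allowed {w : List (PolygonLetter n)} (h : Allowed s w) :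
    actS k (vec k w) = vec k (s :: w) := by
  rcases w with _ | ⟨i | i | _, w⟩
  · exact endOfFun_vec ..
  · exact endOfFun_vec ..
  · rw [actS_vec_p]
    rcases w with _ | ⟨j | j | _, w⟩
    · obtain rfl : i = 0 := h
      simp [funSP]
    · obtain ⟨rfl, rfl⟩ : i = 0 ∧ j = 1 := h
      simp [funSP]
    · obtain rfl : i = 0 := h
      simp [funSP]
    · obtain rfl : i = 0 := h
      simp [funSP]
  · exact endOfFun_vec ..

variable (hn : 2 ≤ n)
include hn

theorem allowed_p_b_succ (i : ZMod n) (w : List (PolygonLetter n)) :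
    Allowed (p i) (b (i + 1) :: w) := by
  have : Fact (1 < n) := ⟨hn⟩
  simp [Allowed]

theorem act_face_rel (i : ZMod n) : actP k i * actB k i - actB k i * actB k i =
    actP k i * actB k (i + 1) - actB k (i + 1) * actB k (i + 1) := by
  refine end_ext k fun w => ?_
  simp only [LinearMap.sub_apply, Module.End.mul_apply, actB_vec, actP_vec_b,
    actP_vec_of_allowed k (allowed_p_b_succ hn i w)]
  abel

/-- The formula defining `s` on words that begin with `pᵢ` persists when `pᵢ w` itself gets
rewritten, that is, for `w = bᵢ w'`. This is the confluence of the overlap `s pᵢ bᵢ`. -/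
theorem actS_actP_vec (i : ZMod n) (w : List (PolygonLetter n)) :
    actS k (actP k i (vec k w)) =
      funSP k w + (actQuad k i (vec k w) - actQuad k 0 (vec k w)) := by
  by_cases h : Allowed (p i) w
  · rw [actP_vec_of_allowed k h, actS_vec_p]
  · obtain ⟨w, rfl⟩ := not_allowed_p_iff.1 h
    -- `cube_sub` is applied in the endomorphism ring, where the face relation is already
    -- established.
    have hc := LinearMap.congr_fun (PolygonRelations.cube_sub
      (R := Module.End k (List (PolygonLetter n) →₀ k)) (act_face_rel k hn) i) (vec k w)
    simp only [← actQuad.eq_1, LinearMap.sub_apply, Module.End.mul_apply, actB_vec, map_sub] at hc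
    rw [actP_vec_b, map_add, map_sub, actS_vec_p, actS_vec_b, actS_vec_b]
    simp only [funSP, actB_vec]
    rw [← sub_eq_zero] at hc ⊢
    rw [← neg_eq_zero, ← hc]
    abel

/-- For the top relation, `s pⱼ - (pⱼ² - qⱼ)` acts on every word, normal or not, by an expression
free of `j`. -/
theorem actRelations : PolygonRelations (actB k (n := n)) (actP k) (actS k) where
  face_rel := act_face_rel k hn
  top_rel i := by
    refine end_ext k fun w => ?_
    have h (j : ZMod n) : ((actS k * actP k j - actP k j * actP k j +
        (actP k j * actB k j - actB k j * actB k j) : Module.End k _)) (vec k w) =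
        funSP k w - actQuad k 0 (vec k w) := by
      have h1 : actS k * actP k j - actP k j * actP k j +
        (actP k j * actB k j - actB k j * actB k j) = actS k * actP k j - actQuad k j := by
        rw [actQuad]; abel
      rw [h1, LinearMap.sub_apply, Module.End.mul_apply, actS_actP_vec k hn]
      abel
    rw [h, h]

end Action

/-! ### Normal words form a basis -/

section Basis

open polygonGraph

variable (k : Type*) [Field k] {n : ℕ}

/-- The generator of `A(Γ_{D_n})` named by a letter. -/
def gen : PolygonLetter n → (polygonGraph n).Alg k
  | b i => genB k n i
  | p i => genP k n i
  | s => genS k n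

/-- The product of the generators named by the letters of a word. -/
def wordProd (w : List (PolygonLetter n)) : (polygonGraph n).Alg k := (w.map (gen k)).prod

theorem wordProd_cons (x : PolygonLetter n) (w : List (PolygonLetter n)) :
    wordProd k (x :: w) = gen k x * wordProd k w := by
  simp [wordProd]

theorem lift_wordProd [NeZero n] (hn : 2 ≤ n) {w : List (PolygonLetter n)} (hw : Normal w) :
    lift k (actRelations k hn) (wordProd k w) (vec k []) = vec k w := by
  induction w with
  | nil => simp [wordProd]
  | cons x w ih =>
    rw [wordProd_cons, map_mul, Module.End.mul_apply, ih hw.2]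
    rcases x with i | i | _
    · rw [gen, lift_genB, actB_vec]
    · rw [gen, lift_genP, actP_vec_of_allowed k hw.1]
    · rw [gen, lift_genS, actS_vec_of_allowed k hw.1]

theorem linearIndependent_wordProd [NeZero n] (hn : 2 ≤ n) (m : ℕ) :
    LinearIndependent k fun w : normalWords n m => wordProd k (w : List (PolygonLetter n)) := by
  refine LinearIndependent.of_comp
    ((LinearMap.applyₗ (vec k [])).comp (lift k (actRelations k hn)).toLinearMap) ?_
  have h := (Finsupp.basisSingleOne (R := k) (ι := List (PolygonLetter n))).linearIndependent.comp
    (fun w : normalWords n m => (w : List (PolygonLetter n))) Subtype.val_injective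
  convert h using 1
  ext1 w
  simpa using lift_wordProd k hn (mem_normalWords.1 w.2).2

/-- The span of the normal words of length `m`. -/
def normalSpan (n m : ℕ) : Submodule k ((polygonGraph n).Alg k) :=
  Submodule.span k (wordProd k '' {w | w.length = m ∧ Normal w})

variable {k}

theorem wordProd_mem_normalSpan {w : List (PolygonLetter n)} (hw : Normal w) :
    wordProd k w ∈ normalSpan k n w.length :=
  Submodule.subset_span ⟨w, ⟨rfl, hw⟩, rfl⟩

theorem mul_mem_normalSpan {a : (polygonGraph n).Alg k} {m m' : ℕ}
    (ha : ∀ w, w.length = m → Normal w → a * wordProd k w ∈ normalSpan k n m')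
    {x : (polygonGraph n).Alg k} (hx : x ∈ normalSpan k n m) : a * x ∈ normalSpan k n m' := by
  induction hx using Submodule.span_induction with
  | mem x hx => obtain ⟨w, ⟨h1, h2⟩, rfl⟩ := hx; exact ha w h1 h2
  | zero => rw [mul_zero]; exact zero_mem _
  | add x y _ _ hx hy => rw [mul_add]; exact add_mem hx hy
  | smul c x _ hx => rw [mul_smul_comm]; exact Submodule.smul_mem _ _ hx

theorem genB_mul_mem (i : ZMod n) {m : ℕ} {x : (polygonGraph n).Alg k}
    (hx : x ∈ normalSpan k n m) : genB k n i * x ∈ normalSpan k n (m + 1) := by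
  refine mul_mem_normalSpan (fun w hm hw => ?_) hx
  subst hm
  exact wordProd_cons k (b i) w ▸ wordProd_mem_normalSpan (w := b i :: w) ⟨trivial, hw⟩

section

variable (hn : 2 ≤ n)
include hn

theorem genP_mul_mem (i : ZMod n) {m : ℕ} {x : (polygonGraph n).Alg k}
    (hx : x ∈ normalSpan k n m) : genP k n i * x ∈ normalSpan k n (m + 1) := by
  refine mul_mem_normalSpan (fun w hm hw => ?_) hx
  subst hm
  by_cases h : Allowed (p i) w
  · exact wordProd_cons k (p i) w ▸ wordProd_mem_normalSpan (w := p i :: w) ⟨h, hw⟩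
  · obtain ⟨w, rfl⟩ := not_allowed_p_iff.1 h
    have hw' := wordProd_mem_normalSpan (k := k) hw.2
    have h1 := wordProd_mem_normalSpan (k := k) (w := p i :: b (i + 1) :: w)
      ⟨allowed_p_b_succ hn i w, trivial, hw.2⟩
    rw [wordProd_cons, wordProd_cons] at h1
    rw [wordProd_cons, gen, ← mul_assoc, (polygonRelations k).face_rel' i, add_mul, sub_mul,
      mul_assoc, mul_assoc, mul_assoc]
    exact add_mem h1 (sub_mem (genB_mul_mem i (genB_mul_mem i hw'))
      (genB_mul_mem _ (genB_mul_mem _ hw')))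

theorem quad_mul_mem (i : ZMod n) {m : ℕ} {x : (polygonGraph n).Alg k}
    (hx : x ∈ normalSpan k n m) :
    (genP k n i * genP k n i - (genP k n i * genB k n i - genB k n i * genB k n i)) * x ∈
      normalSpan k n (m + 2) := by
  simp only [sub_mul, mul_assoc]
  exact sub_mem (genP_mul_mem hn i (genP_mul_mem hn i hx))
    (sub_mem (genP_mul_mem hn i (genB_mul_mem i hx)) (genB_mul_mem i (genB_mul_mem i hx)))

/-- Here `w` may begin with `b₀`, as happens after `s pᵢ` has been traded for `s p₀`; the comparison
with `s p₀ b₁` covers every `bⱼ`. -/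
theorem genS_mul_genP_zero_mul_mem [NeZero n] {w : List (PolygonLetter n)} (hw : Normal w) :
    genS k n * genP k n 0 * wordProd k w ∈ normalSpan k n (w.length + 2) := by
  have key (h1 : Allowed (p 0) w) (h2 : Allowed s (p 0 :: w)) :
      genS k n * genP k n 0 * wordProd k w ∈ normalSpan k n (w.length + 2) := by
    have := wordProd_mem_normalSpan (k := k) (w := s :: p 0 :: w) ⟨h2, h1, hw⟩
    rwa [wordProd_cons, wordProd_cons, ← mul_assoc] at this
  rcases w with _ | ⟨j | j | _, w⟩
  · exact key trivial rfl
  · have hw' := wordProd_mem_normalSpan (k := k) hw.2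
    have h0 := wordProd_mem_normalSpan (k := k) (w := s :: p 0 :: b 1 :: w)
      ⟨⟨rfl, rfl⟩, by simpa using allowed_p_b_succ hn 0 w, trivial, hw.2⟩
    have h1 (j : ZMod n) := wordProd_mem_normalSpan (k := k) (w := s :: b j :: b j :: w)
      ⟨trivial, trivial, trivial, hw.2⟩
    have h2 (j : ZMod n) := genB_mul_mem j (genB_mul_mem j (genB_mul_mem j hw'))
    have h3 (j : ZMod n) := quad_mul_mem hn 0 (genB_mul_mem j hw')
    simp only [wordProd_cons, gen] at h0 h1
    have := (polygonRelations k (n := n)).top_mul_bot_sub j 1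
    rw [wordProd_cons, gen, ← mul_assoc, mul_assoc (genS k n), this]
    simp only [add_mul, sub_mul _ _ (wordProd k w), mul_assoc] at h0 h1 h2 h3 ⊢
    exact add_mem h0 (sub_mem (add_mem (sub_mem (h1 j) (h2 j)) (h3 j))
      (add_mem (sub_mem (h1 1) (h2 1)) (h3 1)))
  · exact key trivial rfl
  · exact key trivial rfl

theorem genS_mul_mem [NeZero n] {m : ℕ} {x : (polygonGraph n).Alg k}
    (hx : x ∈ normalSpan k n m) : genS k n * x ∈ normalSpan k n (m + 1) := by
  refine mul_mem_normalSpan (fun w hm hw => ?_) hx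
  subst hm
  have key (h : Allowed s w) : genS k n * wordProd k w ∈ normalSpan k n (w.length + 1) :=
    wordProd_cons k s w ▸ wordProd_mem_normalSpan (w := s :: w) ⟨h, hw⟩
  rcases w with _ | ⟨i | i | _, w⟩
  · exact key trivial
  · exact key trivial
  · have hw' := wordProd_mem_normalSpan (k := k) hw.2
    rw [wordProd_cons, gen, ← mul_assoc, (polygonRelations k).top_rel' i, add_mul, sub_mul]
    exact add_mem (genS_mul_genP_zero_mul_mem hn hw.2)
      (sub_mem (quad_mul_mem hn i hw') (quad_mul_mem hn 0 hw'))
  · exact key trivial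

/-- All rewriting rules are homogeneous, so reduction to normal words preserves length. -/
theorem gradedPiece_eq_normalSpan [NeZero n] (m : ℕ) :
    (polygonGraph n).gradedPiece k m = normalSpan k n m := by
  rw [LayeredGraph.gradedPiece_eq_pow, span_edge]
  apply le_antisymm
  · induction m with
    | zero =>
      rw [pow_zero, Submodule.one_le]
      simpa [wordProd] using wordProd_mem_normalSpan (k := k) (n := n) (w := []) trivial
    | succ m ih =>
      rw [pow_succ']
      refine (mul_le_mul_right ih _).trans ?_
      rw [Submodule.mul_le]
      intro a ha x hx
      induction ha using Submodule.span_induction with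
      | mem a ha =>
        obtain (⟨i, rfl⟩ | ⟨i, rfl⟩) | rfl := ha
        · exact genB_mul_mem i hx
        · exact genP_mul_mem hn i hx
        · exact genS_mul_mem hn hx
      | zero => rw [zero_mul]; exact zero_mem _
      | add a a' _ _ h h' => rw [add_mul]; exact add_mem h h'
      | smul c a _ h => rw [smul_mul_assoc]; exact Submodule.smul_mem _ _ h
  · rw [normalSpan, Submodule.span_le]
    rintro _ ⟨w, ⟨rfl, -⟩, rfl⟩
    induction w with
    | nil => exact Submodule.one_le.1 le_rfl
    | cons x w ih =>
      rw [wordProd_cons, List.length_cons, pow_succ']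
      refine Submodule.mul_mem_mul (Submodule.subset_span ?_) ih
      cases x <;> simp [gen]

theorem finrank_gradedPiece [NeZero n] (m : ℕ) :
    Module.finrank k ((polygonGraph n).gradedPiece k m) = (normalWords n m).card := by
  have h := finrank_span_eq_card (linearIndependent_wordProd k hn m)
  rw [Fintype.card_coe] at h
  have hset : wordProd k '' {w | w.length = m ∧ Normal w} =
      Set.range fun w : normalWords n m => wordProd k (w : List (PolygonLetter n)) := by
    ext x
    simp [mem_normalWords]
  rw [gradedPiece_eq_normalSpan hn, normalSpan, hset, h]

end

end Basis

end PolygonLetter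

/-! ### The Hilbert series -/

theorem polygonGraph.hilbertSeries_mul (k : Type*) [Field k] (n : ℕ) (hn : 2 ≤ n) :
    (polygonGraph n).hilbertSeries k *
      (1 - (2 * (n : PowerSeries ℚ) + 1) * PowerSeries.X
          + (2 * (n : PowerSeries ℚ) - 1) * PowerSeries.X ^ 2 - PowerSeries.X ^ 3) = 1 := by
  have : NeZero n := ⟨by lia⟩
  set H := (polygonGraph n).hilbertSeries k with hH
  have hc (m : ℕ) : PowerSeries.coeff m H = ((PolygonLetter.normalWords n m).card : ℤ) := by
    simp [hH, LayeredGraph.hilbertSeries, PolygonLetter.finrank_gradedPiece hn]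
  have h (α β : ℚ) : H * (1 - PowerSeries.C α * PowerSeries.X
      + PowerSeries.C β * PowerSeries.X ^ 2 - PowerSeries.X ^ 3) = H
        - PowerSeries.C α * (H * PowerSeries.X)
        + PowerSeries.C β * (H * PowerSeries.X * PowerSeries.X)
        - H * PowerSeries.X * PowerSeries.X * PowerSeries.X := by ring
  have hα : (2 * (n : PowerSeries ℚ) + 1) = PowerSeries.C (2 * n + 1 : ℚ) := by
    rw [map_add, map_mul, map_ofNat, map_natCast, map_one]
  have hβ : (2 * (n : PowerSeries ℚ) - 1) = PowerSeries.C (2 * n - 1 : ℚ) := by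
    rw [map_sub, map_mul, map_ofNat, map_natCast, map_one]
  rw [hα, hβ, h]
  ext m
  rw [map_sub, map_add, map_sub, PowerSeries.coeff_C_mul, PowerSeries.coeff_C_mul,
    PowerSeries.coeff_one]
  -- Degrees 0, 1, 2 are the initial values; from degree 3 on the recursion makes the coefficient
  -- vanish.
  rcases m with _ | _ | _ | m <;>
    simp only [PowerSeries.coeff_succ_mul_X, PowerSeries.coeff_zero_mul_X, hc, zero_add,
      PolygonLetter.card_normalWords_zero, PolygonLetter.card_normalWords_one,
      PolygonLetter.card_normalWords_two hn, Nat.reduceAdd, if_true]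
  · simp
  · simp
  · simp
  · rw [show m + 1 + 1 + 1 = m + 3 by rfl, show m + 1 + 1 = m + 2 by rfl,
      PolygonLetter.card_normalWords_add_three hn, if_neg (by lia)]
    push_cast
    ring

theorem mainTheorem8 (k : Type*) [Field k] (n : ℕ) (hn : 2 ≤ n) :
    (polygonGraph n).hilbertSeries k =
        (1 - (2 * (n : PowerSeries ℚ) + 1) * PowerSeries.X
          + (2 * (n : PowerSeries ℚ) - 1) * PowerSeries.X ^ 2 - PowerSeries.X ^ 3)⁻¹ ∧
      (polygonGraph n).hilbertSeries k =
        (1 - PowerSeries.X) *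
          (1 - (2 * (n : PowerSeries ℚ) + 2) * PowerSeries.X
            + 4 * (n : PowerSeries ℚ) * PowerSeries.X ^ 2
            - 2 * (n : PowerSeries ℚ) * PowerSeries.X ^ 3 + PowerSeries.X ^ 4)⁻¹ := by
  have h := polygonGraph.hilbertSeries_mul k n hn
  constructor
  · rw [PowerSeries.eq_inv_iff_mul_eq_one (by simp), h]
  · rw [PowerSeries.eq_mul_inv_iff_mul_eq (by simp)]
    -- The quartic denominator is `1 - X` times the cubic one.
    linear_combination (1 - PowerSeries.X) * h
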